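/- Let $d\ge 1$ and equip $\mathbb{R}^{\mathbb{Z}^d}$ with the product $\sigma$-algebra. For $x\in\mathbb{R}^{\mathbb{Z}^d}$ and $k\in\mathbb{Z}^d$ let $\theta_k x=(x_{i+k})_{i\in\mathbb{Z}^d}$ and let $\mathrm{e}(x)=\{k\in\mathbb{Z}^d: |x_k|>1\}$ be the set of exceedance-points of $x$. Let $\mathbb{E}_0$ be the set of all $x$ with $0\in \mathrm{e}(x)$ and $|\mathrm{e}(x)|<\infty$, and let $l_0=\{x:\lim_{|i|\to\infty}|x_i|=0\}$ with the norm $\|x\|=\sup_i|x_i|$. A random element $Y$ of $\{x:|x_0|>1\}$ is exceedance-stationary if $\theta_{\tau(Y)}Y\overset{d}{=}Y$ for every measurable $\tau:B\to\mathbb{Z}^d$ such that $B\subseteq\{x:|x_0|>1\}$ is a Borel set with $P(Y\in B)=1$, $\theta_kx\in B$ for all $x\in B$ and $k\in\mathrm{e}(x)$, and for every $x\in B$ one has $\tau(x)\in\mathrm{e}(x)$ and $k\mapsto k+\tau(\theta_kx)$ is a bijection of $\mathrm{e}(x)$ onto itself. A process $Y$ is the tail process of a stationary real random field $X=(X_i)_{i\in\mathbb{Z}^d}$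 with $P(|X_0|>u)>0$ for all $u$ if $|Y_0|>1$ a.s. and, for every $m\in\mathbb{N}$, the conditional law of $(u^{-1}X_i)_{i\in\{-m,\dots,m\}^d}$ given $|X_0|>u$ converges weakly to the law of $(Y_i)_{i\in\{-m,\dots,m\}^d}$ as $u\to\infty$. The field $X$ is regularly varying with tail index $\alpha>0$ if it has a tail process and $P(|X_0|>uy)/P(|X_0|>u)\to y^{-\alpha}$ as $u\to\infty$ for all $y>0$. **Proposition.** Let $\alpha>0$ and let $Q=(Q_i)_{i\in\mathbb{Z}^d}$ be a random element of $l_0$ with $\|Q\|=1$ a.s. and $E\big[\sum_{k\in\mathbb{Z}^d}|Q_k|^\alpha\big]<\infty$. Let $Z=R\cdot Q$, where $R$ is a $\mathrm{Pareto}(\alpha)$ random variable (that is, $P(R>y)=y^{-\alpha}$ for $y\ge1$) independent of $Q$. Then $E|\mathrm{e}(Z)|<\infty$. Moreover, there is a random element $Y$ of $\mathbb{E}_0$ whose distribution satisfies $$E[h(Y)]=\frac{1}{E|\mathrm{e}(Z)|}\,E\Big[\sum_{k\in \mathrm{e}(Z)}h(\theta_kZ)\Big]\qquad\text{for all measurable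 } h:\mathbb{E}_0\to[0,\infty),$$ and every such $Y$ is exceedance-stationary and is the tail process of some stationary regularly varying random field with tail index $\alpha$. -/

import Mathlib

open MeasureTheory ProbabilityTheory Filter Topology Set
open scoped ENNReal BoundedContinuousFunction

namespace TailField

/-- The lattice `ℤ^d`. Its norm (as a finite product) is the maximum norm. -/
abbrev Lattice (d : ℕ) : Type := Fin d → ℤ

/-- The path space `ℝ^(ℤ^d)`, with the product topology and the product σ-algebra. -/
abbrev Path (d : ℕ) : Type := Lattice d → ℝ

/-- The shift which moves the origin to `k`. -/
def shift {d : ℕ} (k : Lattice d) (x : Path d) : Path d := fun i => x (i + k)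

/-- The set `e(x)` of exceedance-points of `x`. -/
def exc {d : ℕ} (x : Path d) : Set (Lattice d) := {k | 1 < |x k|}

/-- The paths with an exceedance-point at the origin. -/
def pathsExcZero (d : ℕ) : Set (Path d) := {x | (0 : Lattice d) ∈ exc x}

/-- The space `𝔼₀` of paths with finitely many exceedance-points, one of them at the origin. -/
def clustersZero (d : ℕ) : Set (Path d) := {x | x ∈ pathsExcZero d ∧ (exc x).Finite}

/-- The space `l₀` of paths vanishing at infinity. -/
def lZero (d : ℕ) : Set (Path d) :=
  {x | Tendsto (fun i => |x i|) (comap (fun i : Lattice d => ‖i‖) atTop) (𝓝 0)}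

/-- The uniform norm. It is only used for paths in `l₀`, which are bounded. -/
noncomputable def supNorm {d : ℕ} (x : Path d) : ℝ := ⨆ i, |x i|

/-- The number `|e(x)|` of exceedance-points of `x`, in `[0, ∞]`. -/
noncomputable def numExc {d : ℕ} (x : Path d) : ℝ≥0∞ := ((exc x).encard : ℝ≥0∞)

/-- `τ` (whose values outside of `B` are irrelevant) is a bijective exceedance-map on the Borel
set `B` of paths with an exceedance-point at the origin. -/
structure IsBijectiveExcMap {d : ℕ} (B : Set (Path d)) (τ : Path d → Lattice d) : Prop where
  subset : B ⊆ pathsExcZero d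
  measurableSet : MeasurableSet B
  shift_mem : ∀ x ∈ B, ∀ k ∈ exc x, shift k x ∈ B
  measurable : Measurable (fun x : B => τ x)
  mem_exc : ∀ x ∈ B, τ x ∈ exc x
  bijOn : ∀ x ∈ B, BijOn (fun k => k + τ (shift k x)) (exc x) (exc x)

/-- The random path `Y` (with an exceedance-point at the origin) is exceedance-stationary: its
distribution does not change when the origin is moved by an exceedance-map which is bijective on
a set carrying the distribution of `Y`. -/
structure IsExcStationary {d : ℕ} {Ω : Type*} [MeasurableSpace Ω] (P : Measure Ω)
    (Y : Ω → Path d) : Prop where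
  measurable : Measurable Y
  exc_zero : ∀ᵐ ω ∂P, Y ω ∈ pathsExcZero d
  map_shift : ∀ (B : Set (Path d)) (τ : Path d → Lattice d), IsBijectiveExcMap B τ →
    (∀ᵐ ω ∂P, Y ω ∈ B) → P.map (fun ω => shift (τ (Y ω)) (Y ω)) = P.map Y

/-- `Y` is a random element of `𝔼₀` whose distribution is generated by `Z` through the inversion
formula `E h(Y) = (E|e(Z)|)⁻¹ E ∑_{k ∈ e(Z)} h(θ_k Z)`. -/
structure IsGeneratedBy {d : ℕ} {Ω Ω' : Type*} [MeasurableSpace Ω] [MeasurableSpace Ω']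
    (P : Measure Ω) (Z : Ω → Path d) (P' : Measure Ω') (Y : Ω' → Path d) : Prop where
  measurable : Measurable Y
  mem_clustersZero : ∀ᵐ ω ∂P', Y ω ∈ clustersZero d
  inversion : ∀ h : Path d → ℝ≥0∞, Measurable h →
    ∫⁻ ω, h (Y ω) ∂P' =
      (∫⁻ ω, numExc (Z ω) ∂P)⁻¹ * ∫⁻ ω, ∑' k : exc (Z ω), h (shift k.1 (Z ω)) ∂P

/-- `X` is a (strictly) stationary random field. -/
structure IsStationaryField {d : ℕ} {Ω : Type*} [MeasurableSpace Ω] (P : Measure Ω)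
    (X : Ω → Path d) : Prop where
  measurable : Measurable X
  map_shift : ∀ k : Lattice d, P.map (fun ω => shift k (X ω)) = P.map X

/-- The discrete box `{-m, …, m}^d`. -/
abbrev Box (d m : ℕ) : Type := {i : Lattice d // ∀ j, |i j| ≤ (m : ℤ)}

/-- `Y` is the tail process of `X`: one has `|Y_0| > 1` almost surely, and for every `m` the
conditional distribution of `(u⁻¹ X_i)_{i ∈ {-m, …, m}^d}` given `|X_0| > u` converges weakly, as
`u → ∞`, to the distribution of `(Y_i)_{i ∈ {-m, …, m}^d}`. The conditional distributions are
required to make sense for all `u`. -/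
structure IsTailProcess {d : ℕ} {Ω Ω' : Type*} [MeasurableSpace Ω] [MeasurableSpace Ω']
    (P : Measure Ω) (X : Ω → Path d) (P' : Measure Ω') (Y : Ω' → Path d) : Prop where
  measurable : Measurable Y
  exc_zero : ∀ᵐ ω ∂P', 1 < |Y ω 0|
  pos : ∀ u : ℝ, 0 < P {ω | u < |X ω 0|}
  tendsto : ∀ (m : ℕ) (f : (Box d m → ℝ) →ᵇ ℝ),
    Tendsto (fun u : ℝ => ∫ ω, f (fun i => u⁻¹ * X ω i.1) ∂(P[|{ω | u < |X ω 0|}]))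
      atTop (𝓝 (∫ ω, f (fun i => Y ω i.1) ∂P'))

/-- The random field `X` is regularly varying with (tail) index `α`: it has a tail process, and
the function `u ↦ P(|X_0| > u)` is regularly varying with index `-α`. -/
structure IsRegularlyVarying {d : ℕ} {Ω : Type*} [MeasurableSpace Ω] (P : Measure Ω)
    (X : Ω → Path d) (α : ℝ) : Prop where
  index_pos : 0 < α
  exists_tail : ∃ ν : Measure (Path d), IsProbabilityMeasure ν ∧ IsTailProcess P X ν id
  index : ∀ y : ℝ, 0 < y →
    Tendsto (fun u : ℝ => P.real {ω | u * y < |X ω 0|} / P.real {ω | u < |X ω 0|})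
      atTop (𝓝 (y ^ (-α)))

end TailField

/-! Since `|Q_k| ≤ 1`, the Pareto law gives `P(R |Q_k| > 1 | Q) = |Q_k|^α`; summing over `k` bounds
`E|e(Z)|` by the moment of `Q`, and `R > 1` forces at least one exceedance. Hence the inversion
formula can be normalised. Exceedance-stationarity holds pathwise: a bijective exceedance-map
permutes `e(Z)`, so it only reorders the sum over `e(Z)` (`IsBijectiveExcMap.clusterSum_shift`).

The stationary field is a random periodic path. Wrap `Z = R Q` onto a torus of side `n + 1` with `n
= ⌊R^(α/(2d))⌋`, and place the origin at every site of the torus with equal weight. Shifts permute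
the sites, so the resulting measure is shift-invariant; its mass `E (n + 1)^d` is of order at most
`E R^(α/2) < ∞`, so it can be normalised.

An exceedance of `u ≥ 1` needs `R ≥ u`, an event of probability `u^(-α)` given which `R` is
distributed as `u R`. Division by `u` restores `R Q`, but now on a torus of side about `(u
R)^(α/(2d))`. As `u → ∞` the torus opens up to `ℤ^d`, and the sum over exceeding sites tends to the
sum over `e(Z)`, dominated by a multiple of `|e(Z)|` (`tendsto_siteSum`). Ratios of such sums give
the tail process, and the factor `u^(-α)` gives the index. -/

namespace TailField

/-! ### The Pareto law -/

section Pareto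

variable {α : ℝ}

lemma measurable_paretoPDF (t r : ℝ) : Measurable (paretoPDF t r) :=
  (measurable_paretoPDFReal t r).ennreal_ofReal

/-- Conditionally on exceeding the level `u ≥ 1`, a Pareto variable `R` is distributed as `u R`. -/
lemma lintegral_paretoMeasure_indicator_Ici {u : ℝ} (hu : 1 ≤ u)
    {G : ℝ → ℝ≥0∞} (hG : Measurable G) :
    ∫⁻ r, (Ici u).indicator G r ∂(paretoMeasure 1 α)
      = ENNReal.ofReal (u ^ (-α)) * ∫⁻ r, G (u * r) ∂(paretoMeasure 1 α) := by
  have hu0 : 0 < u := by linarith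
  have hpdf := measurable_paretoPDF 1 α
  have hGu : Measurable fun r => G (u * r) := hG.comp (measurable_const_mul u)
  have hF : Measurable fun s => paretoPDF 1 α (u⁻¹ * s) * G s :=
    (hpdf.comp (measurable_const_mul _)).mul hG
  have hsub : ∫⁻ r, paretoPDF 1 α r * G (u * r)
      = ENNReal.ofReal u⁻¹ * ∫⁻ s, paretoPDF 1 α (u⁻¹ * s) * G s := by
    have h := lintegral_map (μ := (volume : Measure ℝ)) hF (measurable_const_mul u)
    rw [Real.map_volume_mul_left hu0.ne', lintegral_smul_measure,
      abs_of_pos (inv_pos.2 hu0), smul_eq_mul] at h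
    rw [h]
    refine lintegral_congr fun r => ?_
    rw [inv_mul_cancel_left₀ hu0.ne']
  rw [paretoMeasure, lintegral_withDensity_eq_lintegral_mul _ hpdf (hG.indicator measurableSet_Ici),
    lintegral_withDensity_eq_lintegral_mul _ hpdf hGu]
  simp only [Pi.mul_apply]
  rw [hsub, ← lintegral_const_mul _ hF, ← lintegral_const_mul _ (hF.const_mul _)]
  refine lintegral_congr fun s => ?_
  by_cases hs : u ≤ s
  · have hs0 : 0 < s := hu0.trans_le hs
    have h1 : 1 ≤ u⁻¹ * s := by rwa [← div_eq_inv_mul, one_le_div hu0]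
    rw [indicator_of_mem (show s ∈ Ici u from hs), paretoPDF_of_le (hu.trans hs),
      paretoPDF_of_le h1, ← mul_assoc, ← mul_assoc, ← ENNReal.ofReal_mul (by positivity),
      ← ENNReal.ofReal_mul (by positivity)]
    congr 2
    have h2 : u ^ (-(α + 1)) = u ^ (-α) * u⁻¹ := by
      rw [neg_add, Real.rpow_add hu0, Real.rpow_neg_one]
    have h3 : u ^ (-α) ≠ 0 := (Real.rpow_pos_of_pos hu0 _).ne'
    rw [Real.mul_rpow (by positivity) hs0.le, Real.inv_rpow hu0.le, h2]
    field_simp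
  · have h1 : u⁻¹ * s < 1 := by
      rw [← div_eq_inv_mul, div_lt_one hu0]; exact not_le.1 hs
    rw [indicator_of_notMem (show s ∉ Ici u from hs), paretoPDF_of_lt h1]
    simp

lemma paretoMeasure_Ici (hα : 0 < α) {u : ℝ} (hu : 1 ≤ u) :
    paretoMeasure 1 α (Ici u) = ENNReal.ofReal (u ^ (-α)) := by
  have : IsProbabilityMeasure (paretoMeasure 1 α) := isProbabilityMeasure_paretoMeasure one_pos hα
  have h := lintegral_paretoMeasure_indicator_Ici (α := α) hu (measurable_const (a := (1 : ℝ≥0∞)))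
  rw [lintegral_indicator measurableSet_Ici] at h
  simpa using h

lemma lintegral_rpow_paretoMeasure_lt_top {β : ℝ} (hβ : β < α) (hα : 0 < α) :
    ∫⁻ r, ENNReal.ofReal (r ^ β) ∂(paretoMeasure 1 α) < ∞ := by
  have hm : Measurable fun r : ℝ => ENNReal.ofReal (r ^ β) := by fun_prop
  rw [paretoMeasure, lintegral_withDensity_eq_lintegral_mul _ (measurable_paretoPDF 1 α) hm]
  have hint : IntegrableOn (fun r : ℝ => α * r ^ (β - α - 1)) (Ici 1) := by
    rw [integrableOn_Ici_iff_integrableOn_Ioi]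
    exact (integrableOn_Ioi_rpow_of_lt (by linarith) one_pos).const_mul α
  refine lt_of_eq_of_lt ?_ hint.lintegral_lt_top
  rw [← lintegral_indicator measurableSet_Ici]
  refine lintegral_congr fun r => ?_
  by_cases hr : 1 ≤ r
  · have hr0 : 0 < r := by linarith
    rw [indicator_of_mem (show r ∈ Ici (1 : ℝ) from hr), Pi.mul_apply, paretoPDF_of_le hr,
      ← ENNReal.ofReal_mul (by positivity), Real.one_rpow, mul_one, mul_assoc,
      ← Real.rpow_add hr0]
    congr 3
    ring
  · rw [indicator_of_notMem (show r ∉ Ici (1 : ℝ) from hr), Pi.mul_apply,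
      paretoPDF_of_lt (not_le.1 hr), zero_mul]

lemma ae_one_lt_paretoMeasure (hα : 0 < α) : ∀ᵐ r ∂(paretoMeasure 1 α), 1 < r := by
  have : IsProbabilityMeasure (paretoMeasure 1 α) := isProbabilityMeasure_paretoMeasure one_pos hα
  have h1 : ∀ᵐ r ∂(paretoMeasure 1 α), r ∈ Ici (1 : ℝ) := by
    refine (mem_ae_iff_prob_eq_one measurableSet_Ici).2 ?_
    simp [paretoMeasure_Ici hα le_rfl]
  have h2 : ∀ᵐ r ∂(paretoMeasure 1 α), r ≠ 1 :=
    (withDensity_absolutelyContinuous _ _).ae_le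
      (by simp [ae_iff] : ∀ᵐ r ∂(volume : Measure ℝ), r ≠ 1)
  filter_upwards [h1, h2] with r hr hr' using lt_of_le_of_ne hr (Ne.symm hr')

end Pareto

/-! ### Exceedance-points and sums over them -/

section Cluster

variable {d : ℕ}

lemma mem_exc {x : Path d} {k : Lattice d} : k ∈ exc x ↔ 1 < |x k| := Iff.rfl

lemma mem_exc_shift {x : Path d} {k j : Lattice d} : j ∈ exc (shift k x) ↔ j + k ∈ exc x := Iff.rfl

lemma shift_shift (j k : Lattice d) (x : Path d) : shift j (shift k x) = shift (j + k) x := by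
  funext i
  simp only [shift, add_assoc]

@[fun_prop]
lemma measurable_shift (k : Lattice d) : Measurable (shift k : Path d → Path d) :=
  measurable_pi_lambda _ fun i => measurable_pi_apply (i + k)

lemma measurableSet_mem_exc (k : Lattice d) : MeasurableSet {x : Path d | k ∈ exc x} :=
  measurableSet_lt measurable_const (measurable_pi_apply k).abs

/-- The sum of `h` over all shifts of `x` which move an exceedance-point to the origin. -/
noncomputable def clusterSum (h : Path d → ℝ≥0∞) (x : Path d) : ℝ≥0∞ :=
  ∑' k : exc x, h (shift k.1 x)

lemma clusterSum_eq_tsum (h : Path d → ℝ≥0∞) (x : Path d) :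
    clusterSum h x = ∑' k, {x | k ∈ exc x}.indicator (fun x => h (shift k x)) x := by
  rw [clusterSum, tsum_subtype (exc x) fun k => h (shift k x)]
  rfl

lemma measurable_clusterSum {h : Path d → ℝ≥0∞} (hh : Measurable h) :
    Measurable (clusterSum h) := by
  have : clusterSum h = fun x => ∑' k, {x | k ∈ exc x}.indicator (fun x => h (shift k x)) x :=
    funext (clusterSum_eq_tsum h)
  rw [this]
  exact Measurable.tsum fun k =>
    (hh.comp (measurable_shift k)).indicator (measurableSet_mem_exc k)

lemma clusterSum_one (x : Path d) : clusterSum (fun _ => 1) x = numExc x :=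
  ENNReal.tsum_set_one _

lemma measurable_numExc : Measurable (numExc : Path d → ℝ≥0∞) := by
  have h : (numExc : Path d → ℝ≥0∞) = clusterSum fun _ => 1 :=
    funext fun x => (clusterSum_one x).symm
  rw [h]
  exact measurable_clusterSum measurable_const

lemma finite_exc_of_numExc_lt_top {x : Path d} (h : numExc x < ∞) : (exc x).Finite := by
  rw [← Set.encard_lt_top_iff]
  rw [numExc] at h
  by_contra hc
  rw [not_lt, top_le_iff] at hc
  rw [hc] at h
  simp at h

lemma one_le_numExc {x : Path d} (h : (exc x).Nonempty) : 1 ≤ numExc x := by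
  rw [numExc]
  exact_mod_cast Set.one_le_encard_iff_nonempty.2 h

lemma abs_le_one_of_supNorm_eq_one {x : Path d} (h : supNorm x = 1) (i : Lattice d) :
    |x i| ≤ 1 := by
  have hb : BddAbove (range fun i => |x i|) := by
    -- The real supremum of an unbounded family is `0` by convention, so the value `1` forces
    -- boundedness.
    by_contra hb
    rw [supNorm, iSup, Real.sSup_of_not_bddAbove hb] at h
    exact zero_ne_one h
  exact h ▸ le_ciSup hb i

/-- The strict inequality `1 < r` makes the argument independent of whether the supremum is
attained. -/
lemma exc_smul_nonempty {x : Path d} (h : supNorm x = 1) {r : ℝ} (hr : 1 < r) :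
    (exc (r • x)).Nonempty := by
  have hr0 : 0 < r := by linarith
  obtain ⟨i, hi⟩ := exists_lt_of_lt_ciSup
    (show r⁻¹ < ⨆ i, |x i| by rw [← supNorm, h]; exact inv_lt_one_of_one_lt₀ hr)
  refine ⟨i, ?_⟩
  rw [mem_exc, Pi.smul_apply, smul_eq_mul, abs_mul, abs_of_pos hr0]
  rwa [inv_lt_iff_one_lt_mul₀' hr0] at hi

end Cluster

/-! ### The inversion formula and exceedance-stationarity -/

section Generated

variable {d : ℕ} {Ω : Type*} [MeasurableSpace Ω] {P : Measure Ω} {Z : Ω → Path d}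
  {Ω' : Type*} [MeasurableSpace Ω'] {P' : Measure Ω'} {Y : Ω' → Path d}

lemma IsGeneratedBy.lintegral_eq (hY : IsGeneratedBy P Z P' Y) {h : Path d → ℝ≥0∞}
    (hh : Measurable h) :
    ∫⁻ ω, h (Y ω) ∂P' = (∫⁻ ω, numExc (Z ω) ∂P)⁻¹ * ∫⁻ ω, clusterSum h (Z ω) ∂P :=
  hY.inversion h hh

/-- The distribution defined by the inversion formula. -/
noncomputable def generatedMeasure (P : Measure Ω) (Z : Ω → Path d) : Measure (Path d) :=
  (∫⁻ ω, numExc (Z ω) ∂P)⁻¹ •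
    Measure.sum fun k : Lattice d => (P.restrict {ω | k ∈ exc (Z ω)}).map fun ω => shift k (Z ω)

lemma lintegral_generatedMeasure (hZ : Measurable Z) {h : Path d → ℝ≥0∞} (hh : Measurable h) :
    ∫⁻ x, h x ∂(generatedMeasure P Z)
      = (∫⁻ ω, numExc (Z ω) ∂P)⁻¹ * ∫⁻ ω, clusterSum h (Z ω) ∂P := by
  have hS : ∀ k, MeasurableSet {ω | k ∈ exc (Z ω)} := fun k => hZ (measurableSet_mem_exc k)
  rw [generatedMeasure, lintegral_smul_measure, lintegral_sum_measure, smul_eq_mul]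
  congr 1
  simp_rw [clusterSum_eq_tsum]
  have hm : ∀ k, Measurable fun ω =>
      {x | k ∈ exc x}.indicator (fun x => h (shift k x)) (Z ω) := fun k =>
    ((hh.comp (measurable_shift k)).indicator (measurableSet_mem_exc k)).comp hZ
  rw [lintegral_tsum fun k => (hm k).aemeasurable]
  refine tsum_congr fun k => ?_
  have hk : Measurable fun ω => shift k (Z ω) := (measurable_shift k).comp hZ
  rw [lintegral_map hh hk, ← lintegral_indicator (hS k)]
  rfl

lemma isProbabilityMeasure_generatedMeasure (hZ : Measurable Z)
    (h0 : ∫⁻ ω, numExc (Z ω) ∂P ≠ 0) (hfin : ∫⁻ ω, numExc (Z ω) ∂P ≠ ∞) :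
    IsProbabilityMeasure (generatedMeasure P Z) := by
  constructor
  rw [← lintegral_one, lintegral_generatedMeasure hZ measurable_const]
  simp_rw [clusterSum_one]
  exact ENNReal.inv_mul_cancel h0 hfin

lemma measurableSet_clustersZero : MeasurableSet (clustersZero d) := by
  have : clustersZero d = {x | 0 ∈ exc x} ∩ {x | numExc x < ∞} := by
    ext x
    refine and_congr Iff.rfl ⟨fun h => ?_, finite_exc_of_numExc_lt_top⟩
    simpa [numExc] using h
  rw [this]
  exact (measurableSet_mem_exc 0).inter (measurable_numExc measurableSet_Iio)

lemma isGeneratedBy_generatedMeasure (hZ : Measurable Z)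
    (hfin : ∫⁻ ω, numExc (Z ω) ∂P ≠ ∞) :
    IsGeneratedBy P Z (generatedMeasure P Z) id where
  measurable := measurable_id
  inversion h hh := lintegral_generatedMeasure hZ hh
  mem_clustersZero := by
    have hm : Measurable ((clustersZero d)ᶜ.indicator fun _ => (1 : ℝ≥0∞)) :=
      measurable_const.indicator measurableSet_clustersZero.compl
    change generatedMeasure P Z (clustersZero d)ᶜ = 0
    rw [← lintegral_indicator_one measurableSet_clustersZero.compl]
    refine (lintegral_generatedMeasure hZ hm).trans ?_
    refine mul_eq_zero_of_right _ ((lintegral_eq_zero_iff ((measurable_clusterSum hm).comp hZ)).2 ?_)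
    filter_upwards [ae_lt_top (measurable_numExc.comp hZ) hfin] with ω hω
    have hf := finite_exc_of_numExc_lt_top hω
    refine ENNReal.tsum_eq_zero.2 fun k => indicator_of_notMem (not_not.2 ⟨?_, ?_⟩) _
    · change _ + _ ∈ exc _
      rw [zero_add]; exact k.2
    · exact Finite.preimage (f := fun j => j + k.1) (add_left_injective k.1).injOn hf

/-- A bijective exceedance-map permutes the exceedance-points. -/
lemma IsBijectiveExcMap.clusterSum_shift {B : Set (Path d)} {τ : Path d → Lattice d}
    (hτ : IsBijectiveExcMap B τ) {x : Path d} (hx : ∀ k ∈ exc x, shift k x ∈ B)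
    (h : Path d → ℝ≥0∞) :
    clusterSum (fun x => h (shift (τ x) x)) x = clusterSum h x := by
  rcases (exc x).eq_empty_or_nonempty with he | ⟨k, hk⟩
  · have : IsEmpty (exc x) := isEmpty_coe_sort.2 he
    simp [clusterSum]
  -- The origin need not lie in `exc x`, so the bijection is available only for the path seen from
  -- an exceedance-point `k`; it is carried back by translation.
  have hb := hτ.bijOn _ (hx k hk)
  have hb' : BijOn (fun j => j + τ (shift j x)) (exc x) (exc x) := by
    have e : ∀ j, (fun m => m + τ (shift m (shift k x))) (j - k) + k = j + τ (shift j x) := by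
      intro j
      simp only [shift_shift, sub_add_cancel]
      abel
    have m : ∀ j ∈ exc x, j - k ∈ exc (shift k x) := by
      intro j hj
      rwa [mem_exc_shift, sub_add_cancel]
    refine ⟨fun j hj => ?_, fun i hi j hj hij => ?_, fun j hj => ?_⟩
    · have := hb.mapsTo (m j hj)
      rw [mem_exc_shift, e] at this
      exact this
    · have h1 : i + τ (shift i x) = j + τ (shift j x) := hij
      rw [← e i, ← e j, add_left_inj] at h1
      exact sub_left_injective (hb.injOn (m i hi) (m j hj) h1)
    · obtain ⟨i, hi, hij⟩ := hb.surjOn (m j hj)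
      refine ⟨i + k, hi, ?_⟩
      change i + k + τ (shift (i + k) x) = j
      rw [← e, add_sub_cancel_right, hij, sub_add_cancel]
  rw [clusterSum, clusterSum, ← (Equiv.ofBijective _ hb'.bijective).tsum_eq fun k : exc x =>
    h (shift k.1 x)]
  refine tsum_congr fun j => ?_
  rw [shift_shift, add_comm]
  rfl

lemma measurable_shift_apply {τ : Path d → Lattice d} (hτ : Measurable τ) :
    Measurable fun x => shift (τ x) x := by
  have h : Measurable fun p : Path d × Lattice d => shift p.2 p.1 :=
    measurable_from_prod_countable_left fun k => measurable_shift k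
  exact h.comp (measurable_id.prodMk hτ)

/-- The inversion formula for the indicator of `Bᶜ` says that the expected number of
exceedance-points from which `Z` looks outside `B` is zero. -/
lemma IsGeneratedBy.ae_forall_exc_mem [IsProbabilityMeasure P'] (hY : IsGeneratedBy P Z P' Y)
    (hZ : Measurable Z) (hfin : ∫⁻ ω, numExc (Z ω) ∂P ≠ ∞) {B : Set (Path d)}
    (hB : MeasurableSet B) (hYB : ∀ᵐ ω ∂P', Y ω ∈ B) :
    ∀ᵐ ω ∂P, ∀ k ∈ exc (Z ω), shift k (Z ω) ∈ B := by
  have hm : Measurable (Bᶜ.indicator fun _ => (1 : ℝ≥0∞)) := measurable_const.indicator hB.compl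
  have h0 : ∫⁻ ω, Bᶜ.indicator (fun _ => (1 : ℝ≥0∞)) (Y ω) ∂P' = 0 :=
    (lintegral_eq_zero_iff (hm.comp hY.measurable)).2
      (hYB.mono fun ω hω => indicator_of_notMem (not_not.2 hω) _)
  rw [hY.lintegral_eq hm, mul_eq_zero, ENNReal.inv_eq_zero, or_iff_right hfin] at h0
  filter_upwards [(lintegral_eq_zero_iff ((measurable_clusterSum hm).comp hZ)).1 h0] with ω hω k hk
  have := ENNReal.tsum_eq_zero.1 hω ⟨k, hk⟩
  by_contra hc
  rw [indicator_of_mem (show shift k (Z ω) ∈ Bᶜ from hc)] at this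
  exact one_ne_zero this

lemma IsGeneratedBy.isExcStationary [IsProbabilityMeasure P'] (hY : IsGeneratedBy P Z P' Y)
    (hZ : Measurable Z) (hfin : ∫⁻ ω, numExc (Z ω) ∂P ≠ ∞) : IsExcStationary P' Y where
  measurable := hY.measurable
  exc_zero := hY.mem_clustersZero.mono fun _ h => h.1
  map_shift B τ hτ hYB := by
    classical
    -- `τ` is measurable only on `B`; an extension by `0` makes it measurable everywhere without
    -- changing it almost surely.
    let σ : Path d → Lattice d := fun x => if x ∈ B then τ x else 0
    have hσ : Measurable σ := by
      refine measurable_of_restrict_of_restrict_compl hτ.measurableSet ?_ ?_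
      · convert hτ.measurable using 1
        funext x
        simp [σ]
      · convert measurable_const (a := (0 : Lattice d)) using 1
        funext x
        have : x.1 ∉ B := x.2
        simp [σ, this]
    have hT := measurable_shift_apply hσ
    have hae : (fun ω => shift (τ (Y ω)) (Y ω)) =ᵐ[P'] fun ω => shift (σ (Y ω)) (Y ω) := by
      filter_upwards [hYB] with ω hω
      simp [σ, hω]
    rw [Measure.map_congr hae]
    refine Measure.ext_of_lintegral _ fun h hh => ?_
    have hTY : Measurable fun ω => shift (σ (Y ω)) (Y ω) := hT.comp hY.measurable
    rw [lintegral_map hh hTY, lintegral_map hh hY.measurable, hY.lintegral_eq hh]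
    refine (hY.lintegral_eq (hh.comp hT)).trans ?_
    congr 1
    refine lintegral_congr_ae ?_
    filter_upwards [hY.ae_forall_exc_mem hZ hfin hτ.measurableSet hYB] with ω hω
    rw [← hτ.clusterSum_shift hω h]
    refine tsum_congr fun k => ?_
    simp [σ, hω k.1 k.2]

end Generated

/-! ### Periodization on a torus -/

section Wrap

variable {d : ℕ}

/-- The path with period `n + 1` in all directions which agrees with `z` on the residues of least
absolute value, seen from the site `a`. -/
def wrap (n : ℕ) (a : Fin d → ZMod (n + 1)) (z : Path d) : Path d :=
  fun i => z fun j => (a j + (i j : ZMod (n + 1))).valMinAbs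

lemma measurable_wrap (n : ℕ) (a : Fin d → ZMod (n + 1)) : Measurable (wrap n a) :=
  measurable_pi_lambda _ fun _ => measurable_pi_apply _

lemma shift_wrap (n : ℕ) (a : Fin d → ZMod (n + 1)) (k : Lattice d) (z : Path d) :
    shift k (wrap n a z) = wrap n (a + fun j => (k j : ZMod (n + 1))) z := by
  funext i
  simp only [shift, wrap, Pi.add_apply, Int.cast_add]
  congr 1
  funext j
  congr 1
  ring

lemma wrap_smul (n : ℕ) (a : Fin d → ZMod (n + 1)) (c : ℝ) (z : Path d) :
    wrap n a (c • z) = c • wrap n a z := rfl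

lemma wrap_apply_zero (n : ℕ) (a : Fin d → ZMod (n + 1)) (z : Path d) :
    wrap n a z 0 = z fun j => (a j).valMinAbs := by
  simp [wrap]

/-- The sum of `h` over all sites of a periodized path. -/
noncomputable def wrapSum (h : Path d → ℝ≥0∞) (n : ℕ) (z : Path d) : ℝ≥0∞ :=
  ∑ a : Fin d → ZMod (n + 1), h (wrap n a z)

lemma measurable_wrapSum {h : Path d → ℝ≥0∞} (hh : Measurable h) :
    Measurable fun p : ℕ × Path d => wrapSum h p.1 p.2 := by
  refine measurable_from_prod_countable_right fun n => ?_
  change Measurable fun z => ∑ a : Fin d → ZMod (n + 1), h (wrap n a z)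
  exact Finset.measurable_fun_sum _ fun a _ => hh.comp (measurable_wrap n a)

lemma measurable_wrapSum_comp {h : Path d → ℝ≥0∞} (hh : Measurable h) {S : Type*}
    [MeasurableSpace S] {n : S → ℕ} (hn : Measurable n) {z : S → Path d} (hz : Measurable z) :
    Measurable fun s => wrapSum h (n s) (z s) := by
  have hm := (measurable_wrapSum hh).comp (hn.prodMk hz)
  simpa only [Function.comp_def] using hm

/-- A shift of the path is a translation of the torus, hence a permutation of its sites. This is the
source of stationarity. -/
lemma wrapSum_shift (h : Path d → ℝ≥0∞) (k : Lattice d) (n : ℕ) (z : Path d) :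
    wrapSum (fun x => h (shift k x)) n z = wrapSum h n z := by
  simp only [wrapSum, shift_wrap]
  exact Equiv.sum_comp (Equiv.addRight _) fun a => h (wrap n a z)

lemma wrapSum_one (n : ℕ) (z : Path d) : wrapSum (fun _ => 1) n z = ((n : ℝ≥0∞) + 1) ^ d := by
  simp [wrapSum, ZMod.card]

lemma injective_valMinAbs_comp (n : ℕ) :
    Function.Injective fun (a : Fin d → ZMod (n + 1)) j => (a j).valMinAbs := fun _ _ h =>
  funext fun j => ZMod.injective_valMinAbs (congrFun h j)

/-- Least absolute residues embed the torus into `ℤ^d`, so wrapping creates no new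
exceedance-points. The bound is uniform in `n` and serves for domination. -/
lemma wrapSum_indicator_le {h : Path d → ℝ≥0∞} {C : ℝ≥0∞} (hC : ∀ x, h x ≤ C) (n : ℕ)
    (z : Path d) : wrapSum ({x | 0 ∈ exc x}.indicator h) n z ≤ C * numExc z := by
  classical
  have h1 : numExc z = ∑' k, (exc z).indicator (fun _ => (1 : ℝ≥0∞)) k := by
    rw [← tsum_subtype (exc z) fun _ => (1 : ℝ≥0∞), ENNReal.tsum_set_one]; rfl
  rw [h1, wrapSum, ← tsum_fintype (L := .unconditional _), ← ENNReal.tsum_mul_left]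
  refine le_trans (ENNReal.tsum_le_tsum fun a => ?_)
    (ENNReal.tsum_comp_le_tsum_of_injective (injective_valMinAbs_comp n) _)
  simp only [indicator_apply, mem_ofPred_eq, mem_exc, wrap_apply_zero]
  split_ifs
  · simpa using hC _
  · simp

/-- `h` depends only on the values of a path in the box `{-m, …, m}^d`. -/
def DependsOnBox (m : ℕ) (h : Path d → ℝ≥0∞) : Prop :=
  ∀ x y : Path d, (∀ i : Box d m, x i.1 = y i.1) → h x = h y

lemma eventually_wrapSum_eq_clusterSum {h : Path d → ℝ≥0∞} {m : ℕ} (hm : DependsOnBox m h)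
    {z : Path d} (hz : (exc z).Finite) :
    ∀ᶠ n in atTop, wrapSum ({x | 0 ∈ exc x}.indicator h) n z = clusterSum h z := by
  classical
  obtain ⟨N, hN⟩ : ∃ N : ℕ, ∀ k ∈ exc z, ∀ j, |k j| ≤ N := by
    refine ⟨hz.toFinset.sup fun k => Finset.univ.sup fun j => (k j).natAbs, fun k hk j => ?_⟩
    have h1 : (k j).natAbs ≤ Finset.univ.sup fun j => (k j).natAbs :=
      Finset.le_sup (f := fun j => (k j).natAbs) (Finset.mem_univ j)
    have h2 := Finset.le_sup (f := fun k : Lattice d => Finset.univ.sup fun j => (k j).natAbs)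
      (hz.mem_toFinset.2 hk)
    rw [Int.abs_eq_natAbs]
    exact_mod_cast h1.trans h2
  -- For such `n`, integers of absolute value at most `N + m` are their own least absolute residues;
  -- these cover the coordinates of every exceedance-point and of the box of radius `m` around it.
  filter_upwards [eventually_ge_atTop (2 * (N + m))] with n hn
  have hval : ∀ k : ℤ, |k| ≤ N + m → (k : ZMod (n + 1)).valMinAbs = k := by
    intro k hk
    rw [ZMod.valMinAbs_spec]
    rw [abs_le] at hk
    refine ⟨rfl, ?_, ?_⟩ <;> push_cast <;> linarith
  let c : Lattice d → Fin d → ZMod (n + 1) := fun k j => k j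
  have hcv : ∀ k ∈ exc z, ∀ i : Box d m, wrap n (c k) z i.1 = shift k z i.1 := by
    intro k hk i
    simp only [wrap, shift, c]
    congr 1
    funext j
    have := hN k hk j
    have := i.2 j
    rw [← Int.cast_add, hval _ ((abs_add_le _ _).trans (by linarith)), Pi.add_apply, add_comm]
  have hcz : ∀ k ∈ exc z, (fun j => (c k j).valMinAbs) = k := fun k hk =>
    funext fun j => hval _ ((hN k hk j).trans (by linarith))
  have hinj : Set.InjOn c (hz.toFinset : Set (Lattice d)) := by
    intro k hk l hl hkl
    rw [hz.coe_toFinset] at hk hl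
    rw [← hcz k hk, ← hcz l hl, hkl]
  have hcl : clusterSum h z = ∑ k ∈ hz.toFinset, h (shift k z) := by
    rw [clusterSum, ← Finset.tsum_subtype', hz.coe_toFinset]
  rw [hcl, wrapSum, ← Finset.sum_subset (Finset.subset_univ (hz.toFinset.image c)),
    Finset.sum_image hinj]
  · refine Finset.sum_congr rfl fun k hk => ?_
    rw [hz.mem_toFinset] at hk
    rw [indicator_of_mem, hm _ _ (hcv k hk)]
    rw [mem_ofPred_eq, mem_exc, wrap_apply_zero, hcz k hk]
    exact hk
  · intro a _ ha
    refine indicator_of_notMem (fun h0 => ha ?_) _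
    rw [mem_ofPred_eq, mem_exc, wrap_apply_zero] at h0
    refine Finset.mem_image.2 ⟨_, hz.mem_toFinset.2 h0, ?_⟩
    funext j
    exact ZMod.coe_valMinAbs _

/-- The sites of a periodized path, as a measure on the path space. -/
noncomputable def wrapKernel (p : ℕ × Path d) : Measure (Path d) :=
  ∑ a : Fin d → ZMod (p.1 + 1), Measure.dirac (wrap p.1 a p.2)

lemma lintegral_wrapKernel {h : Path d → ℝ≥0∞} (hh : Measurable h) (p : ℕ × Path d) :
    ∫⁻ x, h x ∂(wrapKernel p) = wrapSum h p.1 p.2 := by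
  simp [wrapKernel, wrapSum, lintegral_finsetSum_measure, lintegral_dirac' _ hh]

lemma measurable_wrapKernel : Measurable (wrapKernel : ℕ × Path d → Measure (Path d)) := by
  refine Measure.measurable_of_measurable_coe _ fun s hs => ?_
  have : (fun p : ℕ × Path d => wrapKernel p s) = fun p => wrapSum (s.indicator 1) p.1 p.2 := by
    funext p
    rw [← lintegral_wrapKernel (measurable_one.indicator hs), lintegral_indicator_one hs]
  rw [this]
  exact measurable_wrapSum (measurable_one.indicator hs)

end Wrap

/-- `(R, Q)` is a polar decomposition of a random path: the radius `R` is `Pareto(α)`-distributed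
and independent of the direction `Q`, which has uniform norm one and summable `α`-th moments. -/
structure IsParetoPolar {d : ℕ} {Ω : Type*} [MeasurableSpace Ω] (P : Measure Ω) (R : Ω → ℝ)
    (Q : Ω → Path d) (α : ℝ) : Prop where
  index_pos : 0 < α
  measurable_radius : Measurable R
  measurable_dir : Measurable Q
  map_radius : P.map R = paretoMeasure 1 α
  indep : IndepFun R Q P
  norm_dir : ∀ᵐ ω ∂P, supNorm (Q ω) = 1
  moment : ∫⁻ ω, ∑' k, ENNReal.ofReal (|Q ω k| ^ α) ∂P < ∞

/-! ### Finiteness and positivity of the mean number of exceedance-points -/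

namespace IsParetoPolar

variable {d : ℕ} {Ω : Type*} [MeasurableSpace Ω] {P : Measure Ω}
  {R : Ω → ℝ} {Q : Ω → Path d} {α : ℝ}

lemma lintegral_eq [IsProbabilityMeasure P] (H : IsParetoPolar P R Q α)
    {G : ℝ × Path d → ℝ≥0∞} (hG : Measurable G) :
    ∫⁻ ω, G (R ω, Q ω) ∂P = ∫⁻ ω, ∫⁻ r, G (r, Q ω) ∂(paretoMeasure 1 α) ∂P := by
  have : IsProbabilityMeasure (paretoMeasure 1 α) :=
    isProbabilityMeasure_paretoMeasure one_pos H.index_pos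
  have hlaw := H.indep.map_prod_eq_prod_map_map H.measurable_radius.aemeasurable
    H.measurable_dir.aemeasurable
  rw [← lintegral_map hG (H.measurable_radius.prodMk H.measurable_dir), hlaw, H.map_radius,
    lintegral_prod_symm _ hG.aemeasurable, lintegral_map hG.lintegral_prod_left' H.measurable_dir]

lemma lintegral_indicator_Ici [IsProbabilityMeasure P] (H : IsParetoPolar P R Q α)
    {u : ℝ} (hu : 1 ≤ u) {G : ℝ × Path d → ℝ≥0∞} (hG : Measurable G) :
    ∫⁻ ω, (Ici u).indicator (fun r => G (r, Q ω)) (R ω) ∂P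
      = ENNReal.ofReal (u ^ (-α)) * ∫⁻ ω, G (u * R ω, Q ω) ∂P := by
  have hG1 : Measurable fun p : ℝ × Path d => (Ici u).indicator (fun r => G (r, p.2)) p.1 := by
    have : (fun p : ℝ × Path d => (Ici u).indicator (fun r => G (r, p.2)) p.1)
        = (Prod.fst ⁻¹' Ici u).indicator G := rfl
    rw [this]
    exact hG.indicator (measurable_fst measurableSet_Ici)
  have hG2 : Measurable fun p : ℝ × Path d => G (u * p.1, p.2) :=
    hG.comp ((measurable_fst.const_mul u).prodMk measurable_snd)
  rw [H.lintegral_eq hG1, H.lintegral_eq hG2, ← lintegral_const_mul' _ _ ENNReal.ofReal_ne_top]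
  refine lintegral_congr fun ω => ?_
  exact lintegral_paretoMeasure_indicator_Ici hu (hG.comp measurable_prodMk_right)

lemma ae_one_lt_radius (H : IsParetoPolar P R Q α) : ∀ᵐ ω ∂P, 1 < R ω :=
  ae_of_ae_map H.measurable_radius.aemeasurable
    (H.map_radius ▸ ae_one_lt_paretoMeasure H.index_pos)

lemma measurable_smul (H : IsParetoPolar P R Q α) : Measurable fun ω => R ω • Q ω :=
  H.measurable_radius.smul H.measurable_dir

lemma paretoMeasure_lt_abs_mul_le (H : IsParetoPolar P R Q α) {q : ℝ} (hq : |q| ≤ 1) :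
    paretoMeasure 1 α {r | 1 < |r * q|} ≤ ENNReal.ofReal (|q| ^ α) := by
  rcases eq_or_ne q 0 with rfl | h0
  · simp [not_lt.2 zero_le_one]
  have hq0 : 0 < |q| := abs_pos.2 h0
  have h1 : 1 ≤ |q|⁻¹ := (one_le_inv₀ hq0).2 hq
  -- The condition `|q| ≤ 1` places the threshold `|q|⁻¹` in the range where the Pareto tail is a
  -- pure power.
  have h2 : ENNReal.ofReal (|q| ^ α) = paretoMeasure 1 α (Ici |q|⁻¹) := by
    rw [paretoMeasure_Ici H.index_pos h1, Real.inv_rpow hq0.le, Real.rpow_neg hq0.le, inv_inv]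
  rw [h2]
  refine measure_mono_ae ?_
  filter_upwards [ae_one_lt_paretoMeasure H.index_pos] with r hr hr'
  change 1 < |r * q| at hr'
  rw [abs_mul, abs_of_pos (by linarith)] at hr'
  exact ((inv_lt_iff_one_lt_mul₀ hq0).2 hr').le

lemma lintegral_numExc_lt_top [IsProbabilityMeasure P] (H : IsParetoPolar P R Q α)
    : ∫⁻ ω, numExc (R ω • Q ω) ∂P < ∞ := by
  have hG : Measurable fun p : ℝ × Path d => numExc (p.1 • p.2) :=
    measurable_numExc.comp (measurable_fst.smul measurable_snd)
  refine lt_of_le_of_lt ?_ H.moment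
  rw [H.lintegral_eq hG]
  refine lintegral_mono_ae ?_
  filter_upwards [H.norm_dir] with ω hω
  have hm : ∀ k, Measurable fun r : ℝ =>
      {r : ℝ | 1 < |r * Q ω k|}.indicator (fun _ => (1 : ℝ≥0∞)) r := fun k =>
    measurable_const.indicator (measurableSet_lt measurable_const (by fun_prop))
  have h1 : ∀ r : ℝ, numExc (r • Q ω) =
      ∑' k, {r : ℝ | 1 < |r * Q ω k|}.indicator (fun _ => (1 : ℝ≥0∞)) r := fun r => by
    rw [← clusterSum_one, clusterSum_eq_tsum]
    rfl
  simp_rw [h1]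
  rw [lintegral_tsum fun k => (hm k).aemeasurable]
  refine ENNReal.tsum_le_tsum fun k => ?_
  refine le_trans (le_of_eq ?_)
    (H.paretoMeasure_lt_abs_mul_le (abs_le_one_of_supNorm_eq_one hω k))
  exact lintegral_indicator_one (measurableSet_lt measurable_const (by fun_prop))

lemma lintegral_numExc_ne_zero [IsProbabilityMeasure P] (H : IsParetoPolar P R Q α)
    : ∫⁻ ω, numExc (R ω • Q ω) ∂P ≠ 0 := by
  have h : ∫⁻ _, 1 ∂P ≤ ∫⁻ ω, numExc (R ω • Q ω) ∂P := by
    refine lintegral_mono_ae ?_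
    filter_upwards [H.norm_dir, H.ae_one_lt_radius] with ω h1 h2
    exact one_le_numExc (exc_smul_nonempty h1 h2)
  rw [lintegral_one, measure_univ] at h
  exact (zero_lt_one.trans_le h).ne'

end IsParetoPolar

/-- The period, minus one, with which a path of norm `r` is periodized. -/
noncomputable def level (d : ℕ) (α r : ℝ) : ℕ := ⌊r ^ (α / 2 / d)⌋₊

lemma measurable_level (d : ℕ) (α : ℝ) : Measurable (level d α) :=
  Nat.measurable_floor.comp (measurable_id.pow_const _)

lemma tendsto_level {d : ℕ} (hd : 0 < d) {α : ℝ} (hα : 0 < α) :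
    Tendsto (level d α) atTop atTop :=
  tendsto_nat_floor_atTop.comp (tendsto_rpow_atTop (by positivity))

/-- The exponent `α / 2 / d` keeps the number of sites of order `r^(α/2)`, which is integrable under
`Pareto(α)`, while the period still tends to infinity. The factor `2 ^ d` absorbs the `+ 1` on each
side. -/
lemma level_add_one_pow_le {d : ℕ} (hd : 0 < d) {α r : ℝ} (hα : 0 < α) (hr : 1 ≤ r) :
    ((level d α r : ℝ≥0∞) + 1) ^ d ≤ 2 ^ d * ENNReal.ofReal (r ^ (α / 2)) := by
  have hr0 : 0 ≤ r := by linarith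
  have h1 : (1 : ℝ) ≤ r ^ (α / 2 / d) := Real.one_le_rpow hr (by positivity)
  have h2 : (level d α r : ℝ) + 1 ≤ 2 * r ^ (α / 2 / d) := by
    have := Nat.floor_le (show 0 ≤ r ^ (α / 2 / d) by positivity)
    rw [level]
    linarith
  have h3 : ((level d α r : ℝ≥0∞) + 1) = ENNReal.ofReal ((level d α r : ℝ) + 1) := by
    rw [ENNReal.ofReal_add (by positivity) zero_le_one]
    simp
  have h4 : (r ^ (α / 2 / d)) ^ d = r ^ (α / 2) := by
    rw [← Real.rpow_mul_natCast hr0]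
    congr 1
    field_simp
  have h5 : (2 : ℝ≥0∞) ^ d = ENNReal.ofReal (2 ^ d) := by
    rw [ENNReal.ofReal_pow (by norm_num)]
    simp
  rw [h3, ← ENNReal.ofReal_pow (by positivity), h5, ← ENNReal.ofReal_mul (by positivity), ← h4,
    ← mul_pow]
  exact ENNReal.ofReal_le_ofReal (pow_le_pow_left₀ (by positivity) h2 d)

/-! ### The stationary field -/

variable {d : ℕ} {Ω : Type*} [MeasurableSpace Ω]

/-- The measure with which the sites of the periodized path `R Q` are distributed, the period being
an increasing function of `R`. -/
noncomputable def siteMeasure (P : Measure Ω) (R : Ω → ℝ) (Q : Ω → Path d) (α : ℝ) :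
    Measure (Path d) :=
  (P.map fun ω => (level d α (R ω), R ω • Q ω)).bind wrapKernel

/-- The expected sum of `h` over the exceedance-points of the periodized path `R Q`, if the period
is increased by a shift of scale `u`. -/
noncomputable def siteSum (P : Measure Ω) (R : Ω → ℝ) (Q : Ω → Path d) (α u : ℝ)
    (h : Path d → ℝ≥0∞) : ℝ≥0∞ :=
  ∫⁻ ω, wrapSum ({x | 0 ∈ exc x}.indicator h) (level d α (u * R ω)) (R ω • Q ω) ∂P

/-- The distribution of the stationary random field. -/
noncomputable def fieldMeasure (P : Measure Ω) (R : Ω → ℝ) (Q : Ω → Path d) (α : ℝ) :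
    Measure (Path d) :=
  (siteMeasure P R Q α univ)⁻¹ • siteMeasure P R Q α

namespace IsParetoPolar

variable {P : Measure Ω}
  {R : Ω → ℝ} {Q : Ω → Path d} {α : ℝ}

lemma lintegral_siteMeasure (H : IsParetoPolar P R Q α) {h : Path d → ℝ≥0∞} (hh : Measurable h) :
    ∫⁻ x, h x ∂(siteMeasure P R Q α)
      = ∫⁻ ω, wrapSum h (level d α (R ω)) (R ω • Q ω) ∂P := by
  have hm : Measurable fun ω => (level d α (R ω), R ω • Q ω) :=
    ((measurable_level d α).comp H.measurable_radius).prodMk H.measurable_smul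
  rw [siteMeasure, Measure.lintegral_bind measurable_wrapKernel.aemeasurable hh.aemeasurable]
  simp_rw [lintegral_wrapKernel hh]
  exact lintegral_map (measurable_wrapSum hh) hm

lemma siteMeasure_univ_ne_zero [IsProbabilityMeasure P] (H : IsParetoPolar P R Q α)
    : siteMeasure P R Q α univ ≠ 0 := by
  have h : ∫⁻ _, 1 ∂P ≤ siteMeasure P R Q α univ := by
    rw [← lintegral_one, H.lintegral_siteMeasure measurable_const]
    refine lintegral_mono fun ω => ?_
    rw [wrapSum_one]
    exact one_le_pow₀ le_add_self
  rw [lintegral_one, measure_univ] at h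
  exact (zero_lt_one.trans_le h).ne'

lemma siteMeasure_univ_ne_top (H : IsParetoPolar P R Q α)
    (hd : 0 < d) : siteMeasure P R Q α univ ≠ ∞ := by
  have hα := H.index_pos
  rw [← lintegral_one, H.lintegral_siteMeasure measurable_const]
  have hle : ∫⁻ ω, wrapSum (fun _ => 1) (level d α (R ω)) (R ω • Q ω) ∂P
      ≤ ∫⁻ ω, 2 ^ d * ENNReal.ofReal (R ω ^ (α / 2)) ∂P := by
    refine lintegral_mono_ae ?_
    filter_upwards [H.ae_one_lt_radius] with ω hω
    rw [wrapSum_one]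
    exact level_add_one_pow_le hd hα hω.le
  have hm : Measurable fun r : ℝ => 2 ^ d * ENNReal.ofReal (r ^ (α / 2)) := by fun_prop
  have hm' : Measurable fun r : ℝ => ENNReal.ofReal (r ^ (α / 2)) := by fun_prop
  refine (hle.trans_lt ?_).ne
  rw [← lintegral_map hm H.measurable_radius, H.map_radius, lintegral_const_mul _ hm']
  exact ENNReal.mul_lt_top (by simp) (lintegral_rpow_paretoMeasure_lt_top (by linarith) hα)

lemma isProbabilityMeasure_fieldMeasure [IsProbabilityMeasure P] (H : IsParetoPolar P R Q α)
    (hd : 0 < d) :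
    IsProbabilityMeasure (fieldMeasure P R Q α) :=
  ⟨ENNReal.inv_mul_cancel H.siteMeasure_univ_ne_zero (H.siteMeasure_univ_ne_top hd)⟩

lemma isStationaryField_fieldMeasure (H : IsParetoPolar P R Q α)
    : IsStationaryField (fieldMeasure P R Q α) id where
  measurable := measurable_id
  map_shift k := by
    refine Measure.ext_of_lintegral _ fun h hh => ?_
    have hk : Measurable fun x : Path d => h (shift k x) := hh.comp (measurable_shift k)
    simp only [id]
    rw [lintegral_map hh (measurable_shift k), Measure.map_id, fieldMeasure,
      lintegral_smul_measure, lintegral_smul_measure, H.lintegral_siteMeasure hk,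
      H.lintegral_siteMeasure hh]
    simp_rw [wrapSum_shift]

/-- The exceedances of a high level by the random field. -/
lemma lintegral_siteMeasure_indicator [IsProbabilityMeasure P] (H : IsParetoPolar P R Q α)
    {u : ℝ} (hu : 1 ≤ u) {h : Path d → ℝ≥0∞}
    (hh : Measurable h) :
    ∫⁻ x, {x : Path d | u < |x 0|}.indicator (fun x => h (u⁻¹ • x)) x ∂(siteMeasure P R Q α)
      = ENNReal.ofReal (u ^ (-α)) * siteSum P R Q α u h := by
  classical
  have hu0 : 0 < u := by linarith
  have hU : MeasurableSet {x : Path d | u < |x 0|} :=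
    measurableSet_lt measurable_const (measurable_pi_apply 0).abs
  have hg : Measurable ({x : Path d | u < |x 0|}.indicator fun x => h (u⁻¹ • x)) :=
    (hh.comp (measurable_const_smul _)).indicator hU
  have hG : Measurable fun p : ℝ × Path d =>
      wrapSum ({x : Path d | u < |x 0|}.indicator fun x => h (u⁻¹ • x))
        (level d α p.1) (p.1 • p.2) :=
    measurable_wrapSum_comp hg ((measurable_level d α).comp measurable_fst)
      (measurable_fst.smul measurable_snd)
  have hI := H.lintegral_indicator_Ici hu hG
  rw [H.lintegral_siteMeasure hg, siteSum]
  refine Eq.trans ?_ (hI.trans ?_)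
  · refine lintegral_congr_ae ?_
    filter_upwards [H.norm_dir, H.ae_one_lt_radius] with ω h1 h2
    by_cases hR : u ≤ R ω
    · rw [indicator_of_mem (show R ω ∈ Ici u from hR)]
    -- The wrapped path is bounded by `R`, since `|Q| ≤ 1`; below `u` it contributes nothing.
    · rw [indicator_of_notMem (show R ω ∉ Ici u from hR)]
      refine Finset.sum_eq_zero fun a _ => indicator_of_notMem (fun hc => hR ?_) _
      rw [mem_ofPred_eq, wrap_apply_zero, Pi.smul_apply, smul_eq_mul, abs_mul,
        abs_of_pos (by linarith)] at hc
      exact hc.le.trans (mul_le_of_le_one_right (by linarith)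
        (abs_le_one_of_supNorm_eq_one h1 _))
  -- The factor `u` cancels in the path but survives in the period.
  · congr 1
    refine lintegral_congr fun ω => Finset.sum_congr rfl fun a _ => ?_
    have hw : u⁻¹ • wrap (level d α (u * R ω)) a ((u * R ω) • Q ω)
        = wrap (level d α (u * R ω)) a (R ω • Q ω) := by
      rw [mul_smul, wrap_smul, inv_smul_smul₀ hu0.ne']
    simp only [indicator_apply, hw]
    refine if_congr ?_ rfl rfl
    rw [mem_ofPred_eq, mem_ofPred_eq, mem_exc, mul_smul, wrap_smul, Pi.smul_apply, smul_eq_mul,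
      abs_mul, abs_of_pos hu0]
    exact lt_mul_iff_one_lt_right hu0

/-! ### Limits at high levels: tail process and regular variation -/

lemma ae_numExc_lt_top [IsProbabilityMeasure P] (H : IsParetoPolar P R Q α)
    : ∀ᵐ ω ∂P, numExc (R ω • Q ω) < ∞ :=
  ae_lt_top (measurable_numExc.comp H.measurable_smul) H.lintegral_numExc_lt_top.ne

/-- Dominated convergence: for almost every `ω` the integrand is eventually constant in `u`, because
the period grows past the finite set of exceedance-points. -/
lemma tendsto_siteSum [IsProbabilityMeasure P] (H : IsParetoPolar P R Q α)
    (hd : 0 < d) {h : Path d → ℝ≥0∞} (hh : Measurable h) {m : ℕ}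
    (hm : DependsOnBox m h) {C : ℝ≥0∞} (hC : ∀ x, h x ≤ C) (hCtop : C ≠ ∞) :
    Tendsto (fun u => siteSum P R Q α u h) atTop
      (𝓝 (∫⁻ ω, clusterSum h (R ω • Q ω) ∂P)) := by
  have hg : Measurable ({x | (0 : Lattice d) ∈ exc x}.indicator h) :=
    hh.indicator (measurableSet_mem_exc 0)
  refine tendsto_lintegral_filter_of_dominated_convergence (fun ω => C * numExc (R ω • Q ω))
    (Eventually.of_forall fun u => ?_) (Eventually.of_forall fun u => ?_) ?_ ?_
  · exact measurable_wrapSum_comp hg ((measurable_level d α).comp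
      (H.measurable_radius.const_mul u)) H.measurable_smul
  · exact Eventually.of_forall fun ω => wrapSum_indicator_le hC _ _
  · rw [lintegral_const_mul' _ _ hCtop]
    exact ENNReal.mul_ne_top hCtop H.lintegral_numExc_lt_top.ne
  · filter_upwards [H.ae_numExc_lt_top, H.ae_one_lt_radius] with ω h1 h2
    have hl : Tendsto (fun u => level d α (u * R ω)) atTop atTop :=
      (tendsto_level hd H.index_pos).comp (tendsto_id.atTop_mul_const (by linarith))
    exact tendsto_nhds_of_eventually_eq
      (hl.eventually (eventually_wrapSum_eq_clusterSum hm (finite_exc_of_numExc_lt_top h1)))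

lemma tendsto_siteSum_one [IsProbabilityMeasure P] (H : IsParetoPolar P R Q α) (hd : 0 < d) :
    Tendsto (fun u => siteSum P R Q α u fun _ => 1) atTop
      (𝓝 (∫⁻ ω, numExc (R ω • Q ω) ∂P)) := by
  simpa only [clusterSum_one] using H.tendsto_siteSum hd (h := fun _ => 1) measurable_const
    (m := 0) (fun _ _ _ => rfl) (fun _ => le_rfl) ENNReal.one_ne_top

lemma setLIntegral_fieldMeasure [IsProbabilityMeasure P] (H : IsParetoPolar P R Q α)
    {u : ℝ} (hu : 1 ≤ u) {h : Path d → ℝ≥0∞} (hh : Measurable h) :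
    ∫⁻ x in {x : Path d | u < |x 0|}, h (u⁻¹ • x) ∂(fieldMeasure P R Q α)
      = (siteMeasure P R Q α univ)⁻¹ * ENNReal.ofReal (u ^ (-α)) * siteSum P R Q α u h := by
  rw [← lintegral_indicator (measurableSet_lt measurable_const (measurable_pi_apply 0).abs),
    fieldMeasure, lintegral_smul_measure, H.lintegral_siteMeasure_indicator hu hh, smul_eq_mul,
    mul_assoc]

lemma fieldMeasure_lt_abs [IsProbabilityMeasure P] (H : IsParetoPolar P R Q α)
    {u : ℝ} (hu : 1 ≤ u) :
    fieldMeasure P R Q α {x : Path d | u < |x 0|}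
      = (siteMeasure P R Q α univ)⁻¹ * ENNReal.ofReal (u ^ (-α))
        * siteSum P R Q α u fun _ => 1 := by
  rw [← H.setLIntegral_fieldMeasure hu measurable_const, setLIntegral_one]

lemma fieldMeasure_lt_abs_pos [IsProbabilityMeasure P] (H : IsParetoPolar P R Q α)
    (hd : 0 < d) (u : ℝ) :
    0 < fieldMeasure P R Q α {x : Path d | u < |x 0|} := by
  -- The explicit formula needs a level of at least `1` and a nonzero `siteSum`, so positivity is
  -- proved at some large `v ≥ u` and transferred by monotonicity.
  have h1 := (H.tendsto_siteSum_one hd).eventually_ne H.lintegral_numExc_ne_zero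
  obtain ⟨v, hv, hv1, hvu⟩ :=
    (h1.and ((eventually_ge_atTop 1).and (eventually_ge_atTop u))).exists
  have hsub : {x : Path d | v < |x 0|} ⊆ {x : Path d | u < |x 0|} := fun x hx => hvu.trans_lt hx
  refine lt_of_lt_of_le (pos_iff_ne_zero.2 ?_) (measure_mono hsub)
  have hv0 : 0 < v := by linarith
  rw [H.fieldMeasure_lt_abs hv1]
  refine mul_ne_zero (mul_ne_zero (ENNReal.inv_ne_zero.2 (H.siteMeasure_univ_ne_top hd)) ?_) hv
  rw [Ne, ENNReal.ofReal_eq_zero, not_le]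
  positivity

/-- The normalising constant and `u^(-α)` are common to numerator and denominator and cancel. -/
lemma lintegral_cond_fieldMeasure [IsProbabilityMeasure P] (H : IsParetoPolar P R Q α)
    (hd : 0 < d) {u : ℝ} (hu : 1 ≤ u) {h : Path d → ℝ≥0∞}
    (hh : Measurable h) :
    ∫⁻ x, h (u⁻¹ • x) ∂((fieldMeasure P R Q α)[|{x : Path d | u < |x 0|}])
      = (siteSum P R Q α u fun _ => 1)⁻¹ * siteSum P R Q α u h := by
  have hu0 : 0 < u := by linarith
  have h1 : (siteMeasure P R Q α univ)⁻¹ * ENNReal.ofReal (u ^ (-α)) ≠ 0 := by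
    refine mul_ne_zero (ENNReal.inv_ne_zero.2 (H.siteMeasure_univ_ne_top hd)) ?_
    rw [Ne, ENNReal.ofReal_eq_zero, not_le]
    positivity
  have h2 : (siteMeasure P R Q α univ)⁻¹ * ENNReal.ofReal (u ^ (-α)) ≠ ∞ :=
    ENNReal.mul_ne_top (ENNReal.inv_ne_top.2 H.siteMeasure_univ_ne_zero) ENNReal.ofReal_ne_top
  rw [ProbabilityTheory.cond, lintegral_smul_measure, H.setLIntegral_fieldMeasure hu hh,
    H.fieldMeasure_lt_abs hu, smul_eq_mul, ENNReal.mul_inv (Or.inl h1) (Or.inl h2),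
    mul_mul_mul_comm, ENNReal.inv_mul_cancel h1 h2, one_mul]

lemma isTailProcess_fieldMeasure [IsProbabilityMeasure P] (H : IsParetoPolar P R Q α)
    (hd : 0 < d) {Ω' : Type*} [MeasurableSpace Ω']
    {P' : Measure Ω'} [IsProbabilityMeasure P'] {Y : Ω' → Path d}
    (hY : IsGeneratedBy P (fun ω => R ω • Q ω) P' Y) :
    IsTailProcess (fieldMeasure P R Q α) id P' Y where
  measurable := hY.measurable
  exc_zero := hY.mem_clustersZero.mono fun _ h => h.1
  pos := H.fieldMeasure_lt_abs_pos hd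
  tendsto m f := by
    have := H.isProbabilityMeasure_fieldMeasure hd
    have hcond : ∀ u : ℝ, IsProbabilityMeasure
        ((fieldMeasure P R Q α)[|{x : Path d | u < |x 0|}]) := fun u =>
      cond_isProbabilityMeasure (H.fieldMeasure_lt_abs_pos hd u).ne'
    have hres : ∀ u : ℝ, Measurable fun (x : Path d) (i : Box d m) => u⁻¹ * x i.1 := fun u =>
      measurable_pi_lambda _ fun i => (measurable_pi_apply i.1).const_mul _
    have hresY : Measurable fun ω (i : Box d m) => Y ω i.1 :=
      measurable_pi_lambda _ fun i => (measurable_pi_apply i.1).comp hY.measurable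
    let ν : ℝ → ProbabilityMeasure (Box d m → ℝ) := fun u =>
      ⟨((fieldMeasure P R Q α)[|{x : Path d | u < |x 0|}]).map
        fun x (i : Box d m) => u⁻¹ * x i.1, Measure.isProbabilityMeasure_map (hres u).aemeasurable⟩
    let ν' : ProbabilityMeasure (Box d m → ℝ) :=
      ⟨P'.map fun ω (i : Box d m) => Y ω i.1, Measure.isProbabilityMeasure_map hresY.aemeasurable⟩
    -- Weak convergence is checked on nonnegative test functions, where the inversion formula
    -- applies directly, and is then used for the real-valued `f`.
    have hν : Tendsto ν atTop (𝓝 ν') := by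
      refine ProbabilityMeasure.tendsto_iff_forall_lintegral_tendsto.2 fun g => ?_
      have hgm : Measurable fun y : Box d m → ℝ => (g y : ℝ≥0∞) :=
        g.continuous.measurable.coe_nnreal_ennreal
      let h : Path d → ℝ≥0∞ := fun x => g fun i : Box d m => x i.1
      have hh : Measurable h :=
        hgm.comp (measurable_pi_lambda _ fun i => measurable_pi_apply i.1)
      have hbox : DependsOnBox m h := fun x y hxy => by
        have : (fun i : Box d m => x i.1) = fun i => y i.1 := funext hxy
        simp only [h, this]
      obtain ⟨C, hC⟩ : ∃ C : NNReal, ∀ y, g y ≤ C :=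
        ⟨_, BoundedContinuousFunction.NNReal.upper_bound g⟩
      have hlim := ENNReal.Tendsto.mul
        (tendsto_inv_iff.2 (H.tendsto_siteSum_one hd))
        (Or.inl (ENNReal.inv_ne_zero.2 H.lintegral_numExc_lt_top.ne))
        (H.tendsto_siteSum hd hh hbox (C := C) (fun x => ENNReal.coe_le_coe.2 (hC _))
          ENNReal.coe_ne_top)
        (Or.inr (ENNReal.inv_ne_top.2 H.lintegral_numExc_ne_zero))
      have hY' : ∫⁻ y, g y ∂(ν' : Measure (Box d m → ℝ)) = ∫⁻ ω, h (Y ω) ∂P' :=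
        lintegral_map hgm hresY
      rw [hY', hY.lintegral_eq hh]
      refine hlim.congr' ?_
      filter_upwards [eventually_ge_atTop 1] with u hu
      rw [← H.lintegral_cond_fieldMeasure hd hu hh]
      exact (lintegral_map hgm (hres u)).symm
    have hf := ProbabilityMeasure.tendsto_iff_forall_integral_tendsto.1 hν f
    have hfm : ∀ μ : Measure (Box d m → ℝ), AEStronglyMeasurable f μ := fun μ =>
      f.continuous.aestronglyMeasurable
    have e' : ∫ y, f y ∂(ν' : Measure (Box d m → ℝ)) = ∫ ω, f (fun i => Y ω i.1) ∂P' :=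
      integral_map hresY.aemeasurable (hfm _)
    rw [e'] at hf
    refine hf.congr fun u => ?_
    exact integral_map (hres u).aemeasurable (hfm _)

lemma isRegularlyVarying_fieldMeasure [IsProbabilityMeasure P] (H : IsParetoPolar P R Q α)
    (hd : 0 < d) :
    IsRegularlyVarying (fieldMeasure P R Q α) id α where
  index_pos := H.index_pos
  exists_tail := by
    have := isProbabilityMeasure_generatedMeasure H.measurable_smul H.lintegral_numExc_ne_zero
      H.lintegral_numExc_lt_top.ne
    exact ⟨_, this, H.isTailProcess_fieldMeasure hd
      (isGeneratedBy_generatedMeasure H.measurable_smul H.lintegral_numExc_lt_top.ne)⟩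
  index y hy := by
    set S : ℝ → ℝ := fun u => (siteSum P R Q α u fun _ => 1).toReal with hS
    have hθ : (∫⁻ ω, numExc (R ω • Q ω) ∂P).toReal ≠ 0 :=
      ENNReal.toReal_ne_zero.2 ⟨H.lintegral_numExc_ne_zero, H.lintegral_numExc_lt_top.ne⟩
    have hlim : Tendsto S atTop (𝓝 (∫⁻ ω, numExc (R ω • Q ω) ∂P).toReal) :=
      (ENNReal.tendsto_toReal H.lintegral_numExc_lt_top.ne).comp (H.tendsto_siteSum_one hd)
    have hlim' : Tendsto (fun u => S (u * y)) atTop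
        (𝓝 (∫⁻ ω, numExc (R ω • Q ω) ∂P).toReal) :=
      hlim.comp (tendsto_id.atTop_mul_const hy)
    -- `S (u * y)` and `S u` have the same nonzero limit, so only the power factor remains in the
    -- ratio.
    have hquot := (hlim'.div hlim hθ).const_mul (y ^ (-α))
    rw [div_self hθ, mul_one] at hquot
    refine hquot.congr' ?_
    have hK : ((siteMeasure P R Q α univ)⁻¹).toReal ≠ 0 := ENNReal.toReal_ne_zero.2
      ⟨ENNReal.inv_ne_zero.2 (H.siteMeasure_univ_ne_top hd),
        ENNReal.inv_ne_top.2 H.siteMeasure_univ_ne_zero⟩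
    have hreal : ∀ v : ℝ, 1 ≤ v → (fieldMeasure P R Q α).real {x : Path d | v < |x 0|}
        = ((siteMeasure P R Q α univ)⁻¹).toReal * v ^ (-α) * S v := fun v hv => by
      rw [measureReal_def, H.fieldMeasure_lt_abs hv, ENNReal.toReal_mul, ENNReal.toReal_mul,
        ENNReal.toReal_ofReal (Real.rpow_nonneg (by linarith) _)]
    filter_upwards [eventually_ge_atTop 1,
      (tendsto_id.atTop_mul_const hy).eventually_ge_atTop 1] with u hu huy
    have hu0 : 0 < u := by linarith
    have hua : u ^ (-α) ≠ 0 := (Real.rpow_pos_of_pos hu0 _).ne'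
    simp only [id] at huy ⊢
    rw [hreal u hu, hreal (u * y) huy, Real.mul_rpow hu0.le hy.le, ← mul_assoc, mul_assoc _ _ (S _),
      mul_div_mul_left _ _ (mul_ne_zero hK hua), mul_div_assoc]
    rfl

end IsParetoPolar

end TailField

theorem mainTheorem6 {d : ℕ} (hd : 0 < d) {α : ℝ} (hα : 0 < α)
    {Ω : Type*} [MeasurableSpace Ω] (P : Measure Ω) [IsProbabilityMeasure P]
    (Q : Ω → TailField.Path d) (hQ : Measurable Q)
    (hQ_mem : ∀ᵐ ω ∂P, Q ω ∈ TailField.lZero d)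
    (hQ_norm : ∀ᵐ ω ∂P, TailField.supNorm (Q ω) = 1)
    (hQ_sum : ∫⁻ ω, ∑' k, ENNReal.ofReal (|Q ω k| ^ α) ∂P < ∞)
    (R : Ω → ℝ) (hR : Measurable R) (hR_law : P.map R = paretoMeasure 1 α)
    (hRQ : IndepFun R Q P)
    (Z : Ω → TailField.Path d) (hZ : Z = fun ω => R ω • Q ω) :
    -- the expected number of exceedance-points of `Z` is finite
    ∫⁻ ω, TailField.numExc (Z ω) ∂P < ∞ ∧
    -- the inversion formula does define a probability distribution
    (∃ ν : Measure (TailField.Path d), IsProbabilityMeasure ν ∧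
      TailField.IsGeneratedBy P Z ν id) ∧
    -- a random element with this distribution is exceedance-stationary and is a tail process
    ∀ {Ω' : Type*} [MeasurableSpace Ω'] (P' : Measure Ω') [IsProbabilityMeasure P']
      (Y : Ω' → TailField.Path d), TailField.IsGeneratedBy P Z P' Y →
      TailField.IsExcStationary P' Y ∧
      ∃ (S : Type) (_ : MeasurableSpace S) (μ : Measure S) (_ : IsProbabilityMeasure μ)
        (X : S → TailField.Path d),
        TailField.IsStationaryField μ X ∧ TailField.IsRegularlyVarying μ X α ∧
        TailField.IsTailProcess μ X P' Y := by
  subst hZ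
  have H : TailField.IsParetoPolar P R Q α := ⟨hα, hR, hQ, hR_law, hRQ, hQ_norm, hQ_sum⟩
  have hfin := H.lintegral_numExc_lt_top
  refine ⟨hfin, ⟨TailField.generatedMeasure P fun ω => R ω • Q ω,
    TailField.isProbabilityMeasure_generatedMeasure H.measurable_smul H.lintegral_numExc_ne_zero
      hfin.ne, TailField.isGeneratedBy_generatedMeasure H.measurable_smul hfin.ne⟩, ?_⟩
  intro Ω' _ P' _ Y hY
  exact ⟨hY.isExcStationary H.measurable_smul hfin.ne, TailField.Path d, inferInstance,
    TailField.fieldMeasure P R Q α, H.isProbabilityMeasure_fieldMeasure hd, id,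
    H.isStationaryField_fieldMeasure, H.isRegularlyVarying_fieldMeasure hd,
    H.isTailProcess_fieldMeasure hd hY⟩
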